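/- **Theorem A.** Let $K$ be an infinite field, $N\ge 3$, $R=K[x_0,\dots,x_N]$ the homogeneous coordinate ring of $\mathbb P^N$. For an ideal $I\subset R$ put $I^{(k)}=\bigcap_{P\in \mathrm{Ass}(R/I)}\left(R\cap I^kR_P\right)$, let $\alpha(I)$ be the least degree of a nonzero homogeneous element of $I$, and let $\widehat\alpha(I)=\lim_{k\to\infty}\alpha(I^{(k)})/k=\inf_{k\ge1}\alpha(I^{(k)})/k$ be its Waldschmidt constant. A *fat flat subscheme* of $\mathbb P^N$ is one defined by an ideal $I(W)=\bigcap_i I(L_i)^{m_i}$, where the $L_i$ are finitely many (at least one) nonempty proper linear subspaces, none of which contains another, and $m_i\ge 1$. For every positive integer $d$ there is a fat flat subscheme $W$ of $\mathbb P^N$ with $\alpha(I(W)^{(k)})=dk$ for all $k\ge1$; in particular $\widehat\alpha(I(W))=d$. More precisely, let $d=st$ with $s,t\ge1$, let $1\le e\le N$ with $e\le s$, and put $m=et$. There exist hyperplanes $H_1,\dots,H_s$ in $\mathbb P^N$ in general position (any at most $N+1$ of them have linearly independent equations). For any such hyperplanes, let $S_N(e,s)$ be the star configuration consisting of the $\binom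 se$ intersections $L$ of $e$ of the $H_j$, with ideal $I(S_N(e,s))=\bigcap_L I(L)$. Let $M_1,\dots,M_n$ ($n\ge 0$) be distinct linear subspaces of codimensions between $2$ and $N$, each contained in $\bigcup_j H_j$, with multiplicities $0\le m_i\le t$, such that no $M_i$ with $m_i\geq 1$ contains one of the subspaces $L$ of $S_N(e,s)$. Let $W=\sum_i m_iM_i+m\,S_N(e,s)$ be defined by $I(W)=\bigcap_i I(M_i)^{(m_i)}\cap I(S_N(e,s))^{(m)}$. Then $\alpha(I(W)^{(k)})=dk$ for every $k\ge1$, and $\widehat\alpha(I(W))=d$. If moreover none of the subspaces among the $L$'s and the $M_i$ with $m_i\ge1$ contains another, then $W$ is a fat flat subscheme. -/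

import Mathlib

open MvPolynomial Filter Topology

namespace FatFlat

noncomputable section

/-- The homogeneous coordinate ring `K[x₀, …, x_N]` of `ℙ^N` over `K`. -/
abbrev CoordRing (K : Type*) [Field K] (N : ℕ) : Type _ := MvPolynomial (Fin (N + 1)) K

/-- A linear subspace of `ℙ^N` is given by the corresponding vector subspace of `K^(N+1)`. -/
abbrev LinSub (K : Type*) [Field K] (N : ℕ) : Type _ := Submodule K (Fin (N + 1) → K)

variable {K : Type*} [Field K] {N : ℕ}

/-- The codimension in `ℙ^N` of a linear subspace (equal to that of its cone in `K^(N+1)`). -/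
def codim (L : LinSub K N) : ℕ := Module.finrank K ((Fin (N + 1) → K) ⧸ L)

/-- The linear form `∑ φ(eᵢ) xᵢ` attached to a linear functional `φ` on `K^(N+1)`. -/
def linForm (φ : Module.Dual K (Fin (N + 1) → K)) : CoordRing K N :=
  ∑ i, C (φ (Pi.single i 1)) * X i

/-- The ideal `I(L)` of a linear subspace `L`, generated by the linear forms vanishing on `L`. -/
def linIdeal (L : LinSub K N) : Ideal (CoordRing K N) :=
  Ideal.span (linForm '' (L.dualAnnihilator : Set (Module.Dual K (Fin (N + 1) → K))))

/-- The symbolic power `I^(m)`: the intersection, over the associated primes `P` of `I`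
(that is, of `R ⧸ I`), of the contractions to `R` of `I^m R_P`. -/
def symbolicPower {R : Type*} [CommRing R] (I : Ideal R) (m : ℕ) : Ideal R :=
  ⨅ (P : Ideal R) (hP : P ∈ associatedPrimes R (R ⧸ I)),
    haveI : P.IsPrime := hP.isPrime
    ((I ^ m).map (algebraMap R (Localization.AtPrime P))).comap
      (algebraMap R (Localization.AtPrime P))

/-- `α(I)`: the least degree of a nonzero homogeneous element of `I`. -/
def alpha (I : Ideal (CoordRing K N)) : ℕ :=
  sInf {t : ℕ | ∃ F ∈ I, F ≠ 0 ∧ F.IsHomogeneous t}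

/-- `c` is the Waldschmidt constant of `I`: the limit, as well as the infimum over `k ≥ 1`,
of `α(I^(k)) / k`. -/
def IsWaldschmidtConstant (I : Ideal (CoordRing K N)) (c : ℝ) : Prop :=
  Tendsto (fun k : ℕ => (alpha (symbolicPower I k) : ℝ) / k) atTop (𝓝 c) ∧
    IsGLB {x : ℝ | ∃ k : ℕ, 1 ≤ k ∧ x = (alpha (symbolicPower I k) : ℝ) / k} c

/-- `I` is the ideal of a fat flat subscheme of `ℙ^N`: `I = ⋂ I(L)^(m L)`, where `L` runs over a
finite nonempty set of nonempty proper linear subspaces of `ℙ^N`, none of which contains another,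
and the multiplicities `m L` are positive. -/
def IsFatFlatIdeal (I : Ideal (CoordRing K N)) : Prop :=
  ∃ (S : Finset (LinSub K N)) (m : LinSub K N → ℕ),
    S.Nonempty ∧ (∀ L ∈ S, L ≠ ⊥ ∧ L ≠ ⊤ ∧ 1 ≤ m L) ∧
    IsAntichain (· ≤ ·) (S : Set (LinSub K N)) ∧
    I = ⨅ L ∈ S, linIdeal L ^ m L

/-- The hyperplanes `ker (H j)` of `ℙ^N` are in general position: at most `N + 1` of them always
have linearly independent equations. -/
def InGeneralPosition {s : ℕ} (H : Fin s → Module.Dual K (Fin (N + 1) → K)) : Prop :=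
  ∀ J : Finset (Fin s), J.card ≤ N + 1 → LinearIndependent K (fun j : J => H j)

/-- The linear subspaces of the star configuration `S_N(e, s)`: the intersections of `e` of the
`s` hyperplanes. -/
def starSubspaces {s : ℕ} (H : Fin s → Module.Dual K (Fin (N + 1) → K)) (e : ℕ) :
    Set (LinSub K N) :=
  {L | ∃ J : Finset (Fin s), J.card = e ∧ L = ⨅ j ∈ J, LinearMap.ker (H j)}

/-- The ideal `I(S_N(e, s))` of the star configuration. -/
def starIdeal {s : ℕ} (H : Fin s → Module.Dual K (Fin (N + 1) → K)) (e : ℕ) :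
    Ideal (CoordRing K N) :=
  ⨅ L ∈ starSubspaces H e, linIdeal L

/-- The data of `W'` (a finite set `T` of linear subspaces with multiplicities `μ`): the members
of `T` have codimension between `2` and `N`, lie in the union of the hyperplanes, have
multiplicity at most `t`, and those with positive multiplicity contain no subspace of the star
configuration. -/
structure IsAdmissible {s : ℕ} (H : Fin s → Module.Dual K (Fin (N + 1) → K)) (e t : ℕ)
    (T : Finset (LinSub K N)) (μ : LinSub K N → ℕ) : Prop where
  codim_mem : ∀ M ∈ T, 2 ≤ codim M ∧ codim M ≤ N
  subset_union : ∀ M ∈ T, (M : Set (Fin (N + 1) → K)) ⊆ ⋃ j, (LinearMap.ker (H j) : Set _)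
  mult_le : ∀ M ∈ T, μ M ≤ t
  not_star_le : ∀ M ∈ T, 0 < μ M → ∀ L ∈ starSubspaces H e, ¬ L ≤ M

/-- The ideal `I(W)` of `W = W' + m S_N(e, s)`, where `W' = ∑ μ(M) M` over `M ∈ T`. -/
def ideal {s : ℕ} (H : Fin s → Module.Dual K (Fin (N + 1) → K)) (e m : ℕ)
    (T : Finset (LinSub K N)) (μ : LinSub K N → ℕ) : Ideal (CoordRing K N) :=
  (⨅ M ∈ T, symbolicPower (linIdeal M) (μ M)) ⊓ symbolicPower (starIdeal H e) m

end

end FatFlat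

/-!
Over a projection `p` of `K^(N+1)` onto `L`, the `T`-adic order of `F (p v + T (v - p v))` is the
largest `r` with `F ∈ I(L)^r`. So the order of vanishing along `L` is a valuation, ordinary and
symbolic powers of `I(L)` agree, and `I(W)^(k)` is contained in every `I(L)^(e t k)`, where `L`
runs over the star configuration.

Upper bound: the product of the `s` hyperplanes vanishes to order `e` on each `L` and to order at
least `1` on each `M_i`, so its `t k`-th power is an element of `I(W)^(k)` of degree `s t k`.

Lower bound: let `G ≠ 0` of degree `δ` vanish to order `m` on every `L`, with `e δ < s m`. The
restriction of `G` to a hyperplane `H_i` vanishes to order `m` on a star configuration with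
parameters `(e - 1, s - 1)`, so induction on `e` shows that it is zero. Hence the product of the
hyperplanes divides `G`, and the quotient, with `(δ - s, m - e)` in place of `(δ, m)`, is again a
counterexample; induction on `m` excludes this.
-/

namespace FatFlat

noncomputable section

section LinearAlgebra

variable {K V ι : Type*} [Field K] [AddCommGroup V] [Module K V] {L : Submodule K V}
  {p : V →ₗ[K] V} {φ : Module.Dual K V}

theorem exists_isProj (L : Submodule K V) : ∃ p : V →ₗ[K] V, LinearMap.IsProj L p := by
  obtain ⟨f, hf⟩ := L.subtype.exists_leftInverse_of_injective L.ker_subtype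
  exact ⟨L.subtype ∘ₗ f, fun x => (f x).2,
    fun x hx => congrArg Subtype.val (LinearMap.congr_fun hf ⟨x, hx⟩)⟩

theorem sub_comp_mem_dualAnnihilator (hp : LinearMap.IsProj L p) (φ : Module.Dual K V) :
    φ - φ ∘ₗ p ∈ L.dualAnnihilator :=
  (Submodule.mem_dualAnnihilator _).2 fun v hv => by simp [hp.map_id v hv]

theorem comp_eq_zero_iff_mem_dualAnnihilator (hp : LinearMap.IsProj L p) :
    φ ∘ₗ p = 0 ↔ φ ∈ L.dualAnnihilator := by
  refine ⟨fun h => ?_, fun h => ?_⟩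
  · simpa [h] using sub_comp_mem_dualAnnihilator hp φ
  · exact LinearMap.ext fun v => (Submodule.mem_dualAnnihilator φ).1 h _ (hp.map_mem v)

theorem mem_dualAnnihilator_iff_le_ker : φ ∈ L.dualAnnihilator ↔ L ≤ LinearMap.ker φ :=
  Submodule.mem_dualAnnihilator φ

theorem dualAnnihilator_biInf_ker (H : ι → Module.Dual K V) (J : Finset ι) :
    (⨅ j ∈ J, LinearMap.ker (H j)).dualAnnihilator = Submodule.span K (H '' J) := by
  refine le_antisymm (fun φ hφ => ?_) (Submodule.span_le.2 ?_)
  · rw [mem_dualAnnihilator_iff_le_ker,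
      ← iInf_subtype (f := fun j : J => LinearMap.ker (H j))] at hφ
    rw [Set.image_eq_range]
    exact mem_span_of_iInf_ker_le_ker hφ
  · rintro _ ⟨j, hj, rfl⟩
    exact mem_dualAnnihilator_iff_le_ker.2 (iInf₂_le j hj)

theorem dualAnnihilator_ker (φ : Module.Dual K V) :
    (LinearMap.ker φ).dualAnnihilator = Submodule.span K {φ} := by
  simpa using dualAnnihilator_biInf_ker (fun _ : Unit => φ) Finset.univ

theorem linearIndepOn_comp_of_isProj_ker {H : ι → Module.Dual K V} {i : ι} {J : Set ι}
    (hp : LinearMap.IsProj (LinearMap.ker (H i)) p) (hi : i ∉ J)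
    (hJ : LinearIndepOn K H (insert i J)) : LinearIndepOn K (fun j => H j ∘ₗ p) J := by
  rw [linearIndepOn_insert hi] at hJ
  refine hJ.1.linearIndependent.map (f := p.dualMap) ?_
  rw [← Set.image_eq_range, Submodule.disjoint_def]
  intro φ hφ hker
  obtain ⟨c, rfl⟩ : ∃ c : K, c • H i = φ := by
    rw [← Submodule.mem_span_singleton, ← dualAnnihilator_ker]
    exact (comp_eq_zero_iff_mem_dualAnnihilator hp).1 hker
  by_cases hc : c = 0
  · rw [hc, zero_smul]
  · exact absurd ((Submodule.smul_mem_iff _ hc).1 hφ) hJ.2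

theorem exists_le_of_subset_iUnion [Infinite K] [Finite ι] {M : ι → Submodule K V}
    (h : (L : Set V) ⊆ ⋃ i, (M i : Set V)) : ∃ i, L ≤ M i := by
  have hcover : ⋃ i, ((M i).comap L.subtype : Set L) = Set.univ :=
    Set.eq_univ_of_forall fun v => by simpa using h v.2
  obtain ⟨i, hi⟩ := Subspace.exists_eq_top_of_iUnion_eq_univ hcover
  exact ⟨i, Submodule.comap_subtype_eq_top.1 hi⟩

end LinearAlgebra

variable {K : Type*} [Field K] {N M : ℕ}

section LinearForms

variable {φ : Module.Dual K (Fin (N + 1) → K)}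

/-- `φ ↦ linForm φ` as a linear map. -/
def linFormHom : Module.Dual K (Fin (N + 1) → K) →ₗ[K] CoordRing K N where
  toFun := linForm
  map_add' φ ψ := by simp [linForm, add_mul, Finset.sum_add_distrib]
  map_smul' c φ := by simp [linForm, Finset.mul_sum, mul_assoc, smul_eq_C_mul]

theorem linForm_add (φ ψ : Module.Dual K (Fin (N + 1) → K)) :
    linForm (φ + ψ) = linForm φ + linForm ψ :=
  map_add linFormHom φ ψ

theorem linForm_smul (c : K) (φ : Module.Dual K (Fin (N + 1) → K)) :
    linForm (c • φ) = c • linForm φ :=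
  map_smul linFormHom c φ

theorem linForm_proj (i : Fin (N + 1)) :
    linForm (LinearMap.proj i : Module.Dual K (Fin (N + 1) → K)) = X i := by
  simp [linForm, Pi.single_apply]

theorem isHomogeneous_linForm (φ : Module.Dual K (Fin (N + 1) → K)) :
    (linForm φ).IsHomogeneous 1 :=
  IsHomogeneous.sum _ _ _ fun i _ => isHomogeneous_C_mul_X _ i

theorem linForm_injective :
    Function.Injective (linForm : Module.Dual K (Fin (N + 1) → K) → CoordRing K N) := by
  intro φ ψ h
  have coeff_linForm (χ : Module.Dual K (Fin (N + 1) → K)) (i : Fin (N + 1)) :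
      coeff (Finsupp.single i 1) (linForm χ) = χ (Pi.single i 1) := by
    simp [linForm, coeff_sum, coeff_C_mul, coeff_X, Finsupp.single_left_inj]
  refine LinearMap.pi_ext' fun i => LinearMap.ext_ring ?_
  simpa [coeff_linForm] using congrArg (coeff (Finsupp.single i 1)) h

theorem linForm_eq_zero_iff : linForm φ = 0 ↔ φ = 0 :=
  map_eq_zero_iff (linFormHom (K := K) (N := N)) linForm_injective

section DualLift

variable {A : Type*} [CommRing A] [Algebra K A]

/-- The universal property of `CoordRing K N` as the symmetric algebra of the dual of `K^(N+1)`: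
the algebra homomorphism extending a linear map on linear forms. -/
def dualLift (l : Module.Dual K (Fin (N + 1) → K) →ₗ[K] A) : CoordRing K N →ₐ[K] A :=
  aeval fun i => l (LinearMap.proj i)

theorem dualLift_linForm (l : Module.Dual K (Fin (N + 1) → K) →ₗ[K] A)
    (φ : Module.Dual K (Fin (N + 1) → K)) : dualLift l (linForm φ) = l φ := by
  have hφ : φ = ∑ i, φ (Pi.single i 1) • (LinearMap.proj i : Module.Dual K (Fin (N + 1) → K)) :=
    LinearMap.pi_ext' fun i => LinearMap.ext_ring (by simp [Pi.single_apply])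
  conv_rhs => rw [hφ]
  simp [linForm, dualLift, ← smul_eq_C_mul]

theorem algHom_ext_linForm {f g : CoordRing K N →ₐ[K] A}
    (h : ∀ φ, f (linForm φ) = g (linForm φ)) : f = g :=
  MvPolynomial.algHom_ext fun i => by simpa only [linForm_proj] using h (LinearMap.proj i)

end DualLift

/-- The substitution `F ↦ F ∘ f` of polynomial functions, for a linear map `f`. -/
def pullback (f : (Fin (M + 1) → K) →ₗ[K] (Fin (N + 1) → K)) : CoordRing K N →ₐ[K] CoordRing K M :=
  dualLift (linFormHom ∘ₗ f.dualMap)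

theorem pullback_linForm (f : (Fin (M + 1) → K) →ₗ[K] (Fin (N + 1) → K))
    (φ : Module.Dual K (Fin (N + 1) → K)) : pullback f (linForm φ) = linForm (φ ∘ₗ f) :=
  dualLift_linForm _ φ

theorem totalDegree_pullback_le (f : (Fin (M + 1) → K) →ₗ[K] (Fin (N + 1) → K))
    (F : CoordRing K N) : (pullback f F).totalDegree ≤ F.totalDegree := by
  conv_lhs => rw [← sum_homogeneousComponent F, map_sum]
  refine totalDegree_finsetSum_le fun i hi => ?_
  have hhom : (pullback f (homogeneousComponent i F)).IsHomogeneous (1 * i) :=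
    (homogeneousComponent_isHomogeneous i F).aeval _ fun _ => isHomogeneous_linForm _
  exact hhom.totalDegree_le.trans
    ((one_mul i).trans_le (Nat.lt_succ_iff.1 (Finset.mem_range.1 hi)))

end LinearForms

section LinIdeal

variable {L : LinSub K N} {p : (Fin (N + 1) → K) →ₗ[K] (Fin (N + 1) → K)}
  {φ : Module.Dual K (Fin (N + 1) → K)} {F : CoordRing K N} {r : ℕ}

theorem linForm_mem_linIdeal (hφ : φ ∈ L.dualAnnihilator) : linForm φ ∈ linIdeal L :=
  Ideal.subset_span ⟨φ, hφ, rfl⟩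

theorem linIdeal_le {I : Ideal (CoordRing K N)} :
    linIdeal L ≤ I ↔ ∀ φ ∈ L.dualAnnihilator, linForm φ ∈ I := by
  rw [linIdeal, Ideal.span_le, Set.image_subset_iff]
  rfl

theorem pullback_mem_linIdeal_pow {f : (Fin (M + 1) → K) →ₗ[K] (Fin (N + 1) → K)} {L' : LinSub K M}
    (h : L' ≤ L.comap f) (hF : F ∈ linIdeal L ^ r) : pullback f F ∈ linIdeal L' ^ r := by
  have hle : linIdeal L ≤ (linIdeal L').comap (pullback f) := linIdeal_le.2 fun φ hφ => by
    rw [Ideal.mem_comap, pullback_linForm]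
    refine linForm_mem_linIdeal (mem_dualAnnihilator_iff_le_ker.2 ?_)
    exact h.trans (Submodule.comap_mono (mem_dualAnnihilator_iff_le_ker.1 hφ))
  exact Ideal.le_comap_pow _ r (Ideal.pow_right_mono hle r hF)

/-- The one-parameter family `F ↦ F (p v + T (v - p v))`, a polynomial in the parameter `T`. When
`p` is a projection onto `L`, it joins the restriction of `F` to `L` (at `T = 0`) to `F` itself
(at `T = 1`). -/
def deform (p : (Fin (N + 1) → K) →ₗ[K] (Fin (N + 1) → K)) :
    CoordRing K N →ₐ[K] Polynomial (CoordRing K N) :=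
  dualLift
    { toFun := fun φ => Polynomial.C (linFormHom (φ ∘ₗ p)) +
        Polynomial.X * Polynomial.C (linFormHom (φ - φ ∘ₗ p))
      map_add' := fun φ ψ => by
        simp only [LinearMap.add_comp, map_add, map_sub]
        ring
      map_smul' := fun c φ => by
        simp only [LinearMap.smul_comp, ← smul_sub, map_smul, RingHom.id_apply,
          ← Polynomial.smul_C, smul_add, mul_smul_comm] }

theorem deform_linForm (p : (Fin (N + 1) → K) →ₗ[K] (Fin (N + 1) → K))
    (φ : Module.Dual K (Fin (N + 1) → K)) :
    deform p (linForm φ) = Polynomial.C (linForm (φ ∘ₗ p)) +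
      Polynomial.X * Polynomial.C (linForm (φ - φ ∘ₗ p)) :=
  dualLift_linForm _ φ

theorem deform_linForm_of_mem (hp : LinearMap.IsProj L p) (hφ : φ ∈ L.dualAnnihilator) :
    deform p (linForm φ) = Polynomial.X * Polynomial.C (linForm φ) := by
  rw [deform_linForm, (comp_eq_zero_iff_mem_dualAnnihilator hp).2 hφ, linForm_eq_zero_iff.2 rfl,
    map_zero, zero_add, sub_zero]

theorem eval_one_deform (p : (Fin (N + 1) → K) →ₗ[K] (Fin (N + 1) → K)) (F : CoordRing K N) :
    (deform p F).eval 1 = F := by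
  have h : ((Polynomial.aeval (1 : CoordRing K N)).restrictScalars K).comp (deform p) =
      AlgHom.id K _ := algHom_ext_linForm fun φ => by
    simp [deform_linForm, ← linForm_add]
  simpa [Polynomial.coe_aeval_eq_eval] using DFunLike.congr_fun h F

theorem eval_zero_deform (p : (Fin (N + 1) → K) →ₗ[K] (Fin (N + 1) → K)) (F : CoordRing K N) :
    (deform p F).eval 0 = pullback p F := by
  have h : ((Polynomial.aeval (0 : CoordRing K N)).restrictScalars K).comp (deform p) =
      pullback p := algHom_ext_linForm fun φ => by
    simp [deform_linForm, pullback_linForm]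
  simpa [Polynomial.coe_aeval_eq_eval] using DFunLike.congr_fun h F

theorem deform_mem_reesAlgebra (hp : LinearMap.IsProj L p) (F : CoordRing K N) :
    deform p F ∈ reesAlgebra (linIdeal L) := by
  induction F using MvPolynomial.induction_on with
  | C a =>
    rw [← algebraMap_eq, AlgHom.commutes]
    exact Subalgebra.algebraMap_mem (reesAlgebra (linIdeal L)) (C a)
  | add F G hF hG =>
    rw [map_add]
    exact add_mem hF hG
  | mul_X F i hF =>
    rw [map_mul, ← linForm_proj i, deform_linForm]
    refine mul_mem hF (add_mem (Subalgebra.algebraMap_mem _ _) ?_)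
    rw [mul_comm, Polynomial.C_mul_X_eq_monomial, reesAlgebra.monomial_mem, pow_one]
    exact linForm_mem_linIdeal (sub_comp_mem_dualAnnihilator hp _)

theorem mem_linIdeal_pow_iff (hp : LinearMap.IsProj L p) :
    F ∈ linIdeal L ^ r ↔ Polynomial.X ^ r ∣ deform p F := by
  refine ⟨fun hF => ?_, fun h => ?_⟩
  · have hle : linIdeal L ≤ (Ideal.span {Polynomial.X}).comap (deform p) :=
      linIdeal_le.2 fun φ hφ => Ideal.mem_span_singleton.2 ⟨_, deform_linForm_of_mem hp hφ⟩
    have hmem := Ideal.le_comap_pow _ r (Ideal.pow_right_mono hle r hF)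
    rwa [Ideal.mem_comap, Ideal.span_singleton_pow, Ideal.mem_span_singleton] at hmem
  · rw [← eval_one_deform p F, Polynomial.eval_eq_sum, Polynomial.sum]
    refine Ideal.sum_mem _ fun i _ => ?_
    rw [one_pow, mul_one]
    rcases lt_or_ge i r with hi | hi
    · rw [Polynomial.X_pow_dvd_iff.1 h i hi]
      exact zero_mem _
    · exact Ideal.pow_le_pow_right hi ((mem_reesAlgebra_iff _ _).1 (deform_mem_reesAlgebra hp F) i)

theorem linIdeal_eq_ker_pullback (hp : LinearMap.IsProj L p) :
    linIdeal L = RingHom.ker (pullback p) := by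
  ext F
  rw [← pow_one (linIdeal L), mem_linIdeal_pow_iff hp, pow_one, Polynomial.X_dvd_iff,
    Polynomial.coeff_zero_eq_eval_zero, eval_zero_deform, RingHom.mem_ker]

instance linIdeal_isPrime (L : LinSub K N) : (linIdeal L).IsPrime := by
  obtain ⟨p, hp⟩ := exists_isProj L
  exact linIdeal_eq_ker_pullback hp ▸ RingHom.ker_isPrime _

theorem linForm_mem_linIdeal_iff : linForm φ ∈ linIdeal L ↔ φ ∈ L.dualAnnihilator := by
  obtain ⟨p, hp⟩ := exists_isProj L
  rw [linIdeal_eq_ker_pullback hp, RingHom.mem_ker, pullback_linForm, linForm_eq_zero_iff,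
    comp_eq_zero_iff_mem_dualAnnihilator hp]

theorem linIdeal_le_linIdeal_iff {L' : LinSub K N} : linIdeal L' ≤ linIdeal L ↔ L ≤ L' := by
  rw [linIdeal_le, ← Subspace.dualAnnihilator_le_dualAnnihilator_iff]
  exact forall₂_congr fun φ _ => linForm_mem_linIdeal_iff

theorem linIdeal_ker (φ : Module.Dual K (Fin (N + 1) → K)) :
    linIdeal (LinearMap.ker φ) = Ideal.span {linForm φ} := by
  refine le_antisymm (linIdeal_le.2 fun ψ hψ => ?_) ?_
  · obtain ⟨c, rfl⟩ := Submodule.mem_span_singleton.1 (dualAnnihilator_ker φ ▸ hψ)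
    rw [linForm_smul]
    exact Submodule.smul_of_tower_mem _ c (Ideal.mem_span_singleton_self _)
  · rw [Ideal.span_singleton_le_iff_mem]
    exact linForm_mem_linIdeal (mem_dualAnnihilator_iff_le_ker.2 le_rfl)

theorem mem_linIdeal_ker_iff : F ∈ linIdeal (LinearMap.ker φ) ↔ linForm φ ∣ F := by
  rw [linIdeal_ker, Ideal.mem_span_singleton]

theorem prime_linForm (hφ : φ ≠ 0) : Prime (linForm φ) :=
  (Ideal.span_singleton_prime (linForm_eq_zero_iff.not.2 hφ)).1
    (linIdeal_ker φ ▸ linIdeal_isPrime (LinearMap.ker φ))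

theorem linForm_dvd_linForm_iff {ψ : Module.Dual K (Fin (N + 1) → K)} :
    linForm φ ∣ linForm ψ ↔ ψ ∈ Submodule.span K {φ} := by
  rw [← mem_linIdeal_ker_iff, linForm_mem_linIdeal_iff, dualAnnihilator_ker]

theorem prod_linForm_dvd {ι : Type*} {H : ι → Module.Dual K (Fin (N + 1) → K)} {S : Finset ι}
    (hH : (S : Set ι).Pairwise fun i j => LinearIndepOn K H {i, j})
    (hdvd : ∀ i ∈ S, linForm (H i) ∣ F) : ∏ i ∈ S, linForm (H i) ∣ F := by
  refine Finset.prod_dvd_of_isRelPrime (fun i hi j hj hij => ?_) hdvd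
  have hij' : LinearIndepOn K H {j, i} := Set.pair_comm i j ▸ hH hi hj hij
  have hirr : Irreducible (linForm (H i)) :=
    (prime_linForm (hij'.ne_zero (by simp))).irreducible
  rw [Function.onFun, hirr.isRelPrime_iff_not_dvd, linForm_dvd_linForm_iff]
  rw [linearIndepOn_insert (by simpa using hij.symm), Set.image_singleton] at hij'
  exact hij'.2

end LinIdeal

section VanishingOrder

variable {L : LinSub K N} {φ : Module.Dual K (Fin (N + 1) → K)} {F G : CoordRing K N} {r : ℕ}

/-- The order of vanishing of a polynomial `F` along a linear subspace `L`: the `T`-adic order of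
`F (p v + T (v - p v))` for a chosen projection `p` onto `L`. The choice of `p` does not matter, by
`mem_linIdeal_pow_iff_le_vanishingOrder`. -/
def vanishingOrder (L : LinSub K N) (F : CoordRing K N) : ℕ∞ :=
  emultiplicity Polynomial.X (deform (exists_isProj L).choose F)

theorem mem_linIdeal_pow_iff_le_vanishingOrder :
    F ∈ linIdeal L ^ r ↔ (r : ℕ∞) ≤ vanishingOrder L F := by
  rw [mem_linIdeal_pow_iff (exists_isProj L).choose_spec, pow_dvd_iff_le_emultiplicity]
  rfl

theorem mem_linIdeal_iff_one_le_vanishingOrder : F ∈ linIdeal L ↔ 1 ≤ vanishingOrder L F := by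
  simpa using mem_linIdeal_pow_iff_le_vanishingOrder (L := L) (F := F) (r := 1)

theorem vanishingOrder_mul :
    vanishingOrder L (F * G) = vanishingOrder L F + vanishingOrder L G := by
  rw [vanishingOrder, map_mul, emultiplicity_mul Polynomial.prime_X]
  rfl

theorem vanishingOrder_prod {ι : Type*} (S : Finset ι) (f : ι → CoordRing K N) :
    vanishingOrder L (∏ i ∈ S, f i) = ∑ i ∈ S, vanishingOrder L (f i) := by
  rw [vanishingOrder, map_prod, Finset.emultiplicity_prod Polynomial.prime_X]
  rfl

theorem vanishingOrder_eq_zero_iff : vanishingOrder L F = 0 ↔ F ∉ linIdeal L := by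
  rw [mem_linIdeal_iff_one_le_vanishingOrder, Order.one_le_iff_pos, pos_iff_ne_zero, not_not]

theorem vanishingOrder_linForm_of_mem (hφ : φ ≠ 0) (h : φ ∈ L.dualAnnihilator) :
    vanishingOrder L (linForm φ) = 1 := by
  have hX : emultiplicity Polynomial.X (Polynomial.C (linForm φ)) = 0 := by
    rwa [emultiplicity_eq_zero, Polynomial.X_dvd_iff, Polynomial.coeff_C_zero, linForm_eq_zero_iff]
  rw [vanishingOrder, deform_linForm_of_mem (exists_isProj L).choose_spec h,
    emultiplicity_mul Polynomial.prime_X, hX, add_zero,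
    (FiniteMultiplicity.of_prime_left Polynomial.prime_X Polynomial.X_ne_zero).emultiplicity_self]

theorem vanishingOrder_prod_linForm {ι : Type*} {H : ι → Module.Dual K (Fin (N + 1) → K)}
    {S J : Finset ι} (hJS : J ⊆ S) (hH : ∀ i ∈ S, LinearIndepOn K H (insert i ↑J)) :
    vanishingOrder (⨅ j ∈ J, LinearMap.ker (H j)) (∏ i ∈ S, linForm (H i)) = J.card := by
  classical
  have horder : ∀ i ∈ S, vanishingOrder (⨅ j ∈ J, LinearMap.ker (H j)) (linForm (H i)) =
      if i ∈ J then 1 else 0 := by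
    intro i hi
    split_ifs with hiJ
    · refine vanishingOrder_linForm_of_mem ((hH i hi).ne_zero (Set.mem_insert i _)) ?_
      exact mem_dualAnnihilator_iff_le_ker.2 (iInf₂_le i hiJ)
    · rw [vanishingOrder_eq_zero_iff, linForm_mem_linIdeal_iff, dualAnnihilator_biInf_ker]
      exact ((linearIndepOn_insert (Finset.mem_coe.not.2 hiJ)).1 (hH i hi)).2
  rw [vanishingOrder_prod, Finset.sum_congr rfl horder, Finset.sum_ite_mem,
    Finset.inter_eq_right.2 hJS, Finset.sum_const, nsmul_one]

theorem mem_linIdeal_pow_of_mul_mem (hF : F ∉ linIdeal L) (h : F * G ∈ linIdeal L ^ r) :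
    G ∈ linIdeal L ^ r := by
  rwa [mem_linIdeal_pow_iff_le_vanishingOrder, vanishingOrder_mul,
    vanishingOrder_eq_zero_iff.2 hF, zero_add, ← mem_linIdeal_pow_iff_le_vanishingOrder] at h

end VanishingOrder

section DegreeBound

variable {ι : Type*} {H : ι → Module.Dual K (Fin (N + 1) → K)} {S : Finset ι} {e m : ℕ}
  {G : CoordRing K N}

theorem isHomogeneous_prod_linForm (H : ι → Module.Dual K (Fin (N + 1) → K)) (S : Finset ι) :
    (∏ i ∈ S, linForm (H i)).IsHomogeneous S.card := by
  simpa using IsHomogeneous.prod S (fun i => linForm (H i)) (fun _ => 1)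
    fun i _ => isHomogeneous_linForm (H i)

theorem totalDegree_prod_linForm (hH : ∀ i ∈ S, H i ≠ 0) :
    (∏ i ∈ S, linForm (H i)).totalDegree = S.card :=
  (isHomogeneous_prod_linForm H S).totalDegree
    (Finset.prod_ne_zero_iff.2 fun i hi => linForm_eq_zero_iff.not.2 (hH i hi))

theorem card_mul_le_of_forall_linForm_dvd (he : 1 ≤ e)
    (hH : ∀ J ⊆ S, J.card ≤ e + 1 → LinearIndepOn K H J)
    (hdvd : ∀ (m : ℕ) (G : CoordRing K N), G ≠ 0 →
      (∀ J ∈ S.powersetCard e, G ∈ linIdeal (⨅ j ∈ J, LinearMap.ker (H j)) ^ m) →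
      e * G.totalDegree < S.card * m → ∀ i ∈ S, linForm (H i) ∣ G)
    (hG0 : G ≠ 0) (hG : ∀ J ∈ S.powersetCard e, G ∈ linIdeal (⨅ j ∈ J, LinearMap.ker (H j)) ^ m) :
    S.card * m ≤ e * G.totalDegree := by
  classical
  induction m using Nat.strong_induction_on generalizing G with
  | _ m ih =>
    by_contra! hlt
    have hm : 0 < m := Nat.pos_of_mul_pos_left (Nat.zero_lt_of_lt hlt)
    have hpair : (S : Set ι).Pairwise fun i j => LinearIndepOn K H {i, j} := by
      intro i hi j hj _
      simpa using hH {i, j} (by grind) (Finset.card_le_two.trans (by lia))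
    have hne : ∀ i ∈ S, H i ≠ 0 := fun i hi =>
      (hH {i} (by simpa using hi) (by simp)).ne_zero (by simp)
    obtain ⟨F, rfl⟩ := prod_linForm_dvd hpair (hdvd m G hG0 hG hlt)
    have hF : ∀ J ∈ S.powersetCard e, F ∈ linIdeal (⨅ j ∈ J, LinearMap.ker (H j)) ^ (m - e) := by
      intro J hJ
      obtain ⟨hJS, hJe⟩ := Finset.mem_powersetCard.1 hJ
      have horder := vanishingOrder_prod_linForm hJS fun i hi => by
        simpa using hH (insert i J) (Finset.insert_subset hi hJS)
          ((Finset.card_insert_le i J).trans (by lia))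
      have hle := mem_linIdeal_pow_iff_le_vanishingOrder.1 (hG J hJ)
      rw [vanishingOrder_mul, horder, hJe] at hle
      rwa [mem_linIdeal_pow_iff_le_vanishingOrder, ENat.natCast_sub, tsub_le_iff_left]
    have hbound := ih (m - e) (by lia) (right_ne_zero_of_mul hG0) hF
    rw [totalDegree_mul_of_isDomain (left_ne_zero_of_mul hG0) (right_ne_zero_of_mul hG0),
      totalDegree_prod_linForm hne] at hlt
    refine hlt.not_ge ?_
    calc S.card * m ≤ S.card * (e + (m - e)) := by gcongr; lia
      _ = e * S.card + S.card * (m - e) := by ring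
      _ ≤ e * (S.card + F.totalDegree) := by rw [mul_add]; gcongr

theorem pullback_mem_linIdeal_biInf_ker_pow [DecidableEq ι] {i : ι} {J : Finset ι}
    {p : (Fin (N + 1) → K) →ₗ[K] (Fin (N + 1) → K)}
    (hp : LinearMap.IsProj (LinearMap.ker (H i)) p)
    (hG : G ∈ linIdeal (⨅ j ∈ insert i J, LinearMap.ker (H j)) ^ m) :
    pullback p G ∈ linIdeal (⨅ j ∈ J, LinearMap.ker (H j ∘ₗ p)) ^ m := by
  refine pullback_mem_linIdeal_pow (fun v hv => ?_) hG
  rw [Finset.iInf_insert, Submodule.mem_comap, Submodule.mem_inf]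
  simp only [Submodule.mem_iInf] at hv ⊢
  exact ⟨hp.map_mem v, hv⟩

theorem card_mul_le_mul_totalDegree (he : 1 ≤ e) (heS : e ≤ S.card)
    (hH : ∀ J ⊆ S, J.card ≤ e + 1 → LinearIndepOn K H J) (hG0 : G ≠ 0)
    (hG : ∀ J ∈ S.powersetCard e, G ∈ linIdeal (⨅ j ∈ J, LinearMap.ker (H j)) ^ m) :
    S.card * m ≤ e * G.totalDegree := by
  classical
  induction e, he using Nat.le_induction generalizing H S m G with
  | base =>
    refine card_mul_le_of_forall_linForm_dvd le_rfl hH (fun m G _ hG hlt i hi => ?_) hG0 hG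
    have hm : m ≠ 0 := (Nat.pos_of_mul_pos_left (Nat.zero_lt_of_lt hlt)).ne'
    have hGi : G ∈ linIdeal (LinearMap.ker (H i)) ^ m := by
      simpa using hG {i} (by simpa [Finset.mem_powersetCard] using hi)
    exact mem_linIdeal_ker_iff.1 (Ideal.pow_le_self hm hGi)
  | succ e he ih =>
    refine card_mul_le_of_forall_linForm_dvd (by lia) hH (fun m G _ hG hlt i hi => ?_) hG0 hG
    obtain ⟨p, hp⟩ := exists_isProj (LinearMap.ker (H i))
    by_contra hndvd
    have hne : pullback p G ≠ 0 := fun h =>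
      hndvd (mem_linIdeal_ker_iff.1 (linIdeal_eq_ker_pullback hp ▸ h))
    have hcard : (S.erase i).card + 1 = S.card := Finset.card_erase_add_one hi
    have hinsert {J : Finset ι} (hJ : J ⊆ S.erase i) :
        i ∉ J ∧ insert i J ⊆ S ∧ (insert i J).card = J.card + 1 := by
      have hiJ : i ∉ J := fun h => Finset.notMem_erase i S (hJ h)
      exact ⟨hiJ, Finset.insert_subset hi (hJ.trans (Finset.erase_subset i S)),
        Finset.card_insert_of_notMem hiJ⟩
    have hbound : (S.erase i).card * m ≤ e * (pullback p G).totalDegree := by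
      refine ih (H := fun j => H j ∘ₗ p) (by lia) (fun J hJ hJe => ?_) hne fun J hJ => ?_
      · obtain ⟨hiJ, hsub, hJcard⟩ := hinsert hJ
        exact linearIndepOn_comp_of_isProj_ker hp hiJ
          (by simpa using hH (insert i J) hsub (by lia))
      · obtain ⟨hJS, hJe⟩ := Finset.mem_powersetCard.1 hJ
        obtain ⟨_, hsub, hJcard⟩ := hinsert hJS
        exact pullback_mem_linIdeal_biInf_ker_pow hp
          (hG _ (Finset.mem_powersetCard.2 ⟨hsub, by lia⟩))
    have hbound' : (S.erase i).card * m ≤ e * G.totalDegree :=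
      hbound.trans (Nat.mul_le_mul_left e (totalDegree_pullback_le p G))
    have hm : m ≤ G.totalDegree := by
      have hle : e ≤ (S.erase i).card := by lia
      exact le_of_mul_le_mul_left (hbound'.trans (Nat.mul_le_mul_right _ hle)) (he.trans hle)
    rw [← hcard, add_one_mul, add_one_mul] at hlt
    lia

end DegreeBound

section SymbolicPower

variable {R ι : Type*} [CommRing R] {I J P : Ideal R} {S : Set ι} {f : ι → Ideal R} {i : ι}
  {n : ι → ℕ} {k m : ℕ} {x : R}

theorem mem_symbolicPower_iff :
    x ∈ symbolicPower I m ↔ ∀ P ∈ associatedPrimes R (R ⧸ I), ∃ u ∉ P, u * x ∈ I ^ m := by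
  simp only [symbolicPower, Submodule.mem_iInf]
  refine forall₂_congr fun P hP => ?_
  have : P.IsPrime := hP.isPrime
  rw [Ideal.mem_comap, IsLocalization.algebraMap_mem_map_algebraMap_iff P.primeCompl]
  rfl

theorem pow_le_symbolicPower (I : Ideal R) (m : ℕ) : I ^ m ≤ symbolicPower I m := fun x hx =>
  mem_symbolicPower_iff.2 fun P hP =>
    ⟨1, (Ideal.ne_top_iff_one P).1 hP.isPrime.ne_top, by rwa [one_mul]⟩

theorem symbolicPower_le (hP : P ∈ associatedPrimes R (R ⧸ I)) (hIJ : I ^ m ≤ J)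
    (hsat : ∀ u ∉ P, ∀ x, u * x ∈ J → x ∈ J) : symbolicPower I m ≤ J := fun x hx => by
  obtain ⟨u, hu, hux⟩ := mem_symbolicPower_iff.1 hx P hP
  exact hsat u hu x (hIJ hux)

theorem exists_le_of_biInf_le (hS : S.Finite) (hP : P.IsPrime) (h : ⨅ i ∈ S, f i ≤ P) :
    ∃ i ∈ S, f i ≤ P := by
  simp only [← hS.mem_toFinset] at h ⊢
  rwa [← Finset.inf_eq_iInf, hP.inf_le'] at h

theorem exists_le_of_mem_associatedPrimes_biInf (hf : ∀ i ∈ S, (f i).IsPrime)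
    (hP : P ∈ associatedPrimes R (R ⧸ ⨅ i ∈ S, f i)) : ∃ i ∈ S, P ≤ f i := by
  obtain ⟨hprime, y, hy⟩ := hP
  obtain ⟨x, rfl⟩ := Ideal.Quotient.mk_surjective y
  have hmem (r : R) : r ∈ P ↔ ∃ k, ∀ i ∈ S, r ^ k * x ∈ f i := by
    simp only [hy, Ideal.mem_radical_iff, Submodule.mem_colon_singleton, Submodule.mem_bot,
      Algebra.smul_def, Ideal.Quotient.algebraMap_eq, ← map_mul, Ideal.Quotient.eq_zero_iff_mem,
      Submodule.mem_iInf]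
  obtain ⟨i, hi, hx⟩ : ∃ i ∈ S, x ∉ f i := by
    by_contra! hx
    exact hprime.ne_top ((Ideal.eq_top_iff_one P).2 ((hmem 1).2 ⟨0, by simpa using hx⟩))
  refine ⟨i, hi, fun r hr => ?_⟩
  obtain ⟨k, hk⟩ := (hmem r).1 hr
  exact (hf i hi).mem_of_pow_mem k (((hf i hi).mem_or_mem (hk i hi)).resolve_right hx)

theorem mem_minimalPrimes_biInf_pow (hS : S.Finite) (hi : i ∈ S) (hprime : (f i).IsPrime)
    (hn : n i ≠ 0) (hmin : ∀ j ∈ S, f j ≤ f i → f j = f i) :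
    f i ∈ (⨅ j ∈ S, f j ^ n j).minimalPrimes := by
  refine ⟨⟨hprime, (iInf₂_le i hi).trans (Ideal.pow_le_self hn)⟩, fun Q ⟨hQ, hle⟩ hQi => ?_⟩
  obtain ⟨j, hj, hjQ⟩ := exists_le_of_biInf_le hS hQ hle
  have hjQ' : f j ≤ Q := hQ.le_of_pow_le hjQ
  exact hmin j hj (hjQ'.trans hQi) ▸ hjQ'

theorem symbolicPower_biInf_pow_le [IsNoetherianRing R] (hS : S.Finite) (hi : i ∈ S)
    (hprime : (f i).IsPrime) (hn : n i ≠ 0) (hmin : ∀ j ∈ S, f j ≤ f i → f j = f i)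
    (hsat : ∀ u ∉ f i, ∀ x, u * x ∈ f i ^ (n i * k) → x ∈ f i ^ (n i * k)) :
    symbolicPower (⨅ j ∈ S, f j ^ n j) k ≤ f i ^ (n i * k) := by
  refine symbolicPower_le ?_ (pow_mul (f i) _ _ ▸ Ideal.pow_right_mono (iInf₂_le i hi) k) hsat
  apply Module.associatedPrimes.minimalPrimes_annihilator_subset_associatedPrimes
  rw [Ideal.annihilator_quotient]
  exact mem_minimalPrimes_biInf_pow hS hi hprime hn hmin

theorem symbolicPower_biInf [IsNoetherianRing R] (hS : S.Finite) (hprime : ∀ i ∈ S, (f i).IsPrime)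
    (hanti : ∀ i ∈ S, ∀ j ∈ S, f j ≤ f i → j = i)
    (hsat : ∀ i ∈ S, ∀ u ∉ f i, ∀ x, u * x ∈ f i ^ m → x ∈ f i ^ m) :
    symbolicPower (⨅ i ∈ S, f i) m = ⨅ i ∈ S, f i ^ m := by
  refine le_antisymm (le_iInf₂ fun i hi => ?_) fun x hx => mem_symbolicPower_iff.2 fun P hP => ?_
  · simpa using symbolicPower_biInf_pow_le (n := 1) (k := m) hS hi (hprime i hi) one_ne_zero
      (fun j hj hji => hanti i hi j hj hji ▸ rfl) (by simpa using hsat i hi)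
  · obtain ⟨i, hi, hPi⟩ := exists_le_of_mem_associatedPrimes_biInf hprime hP
    have hother : ¬ ⨅ j ∈ S \ {i}, f j ≤ f i := fun h => by
      obtain ⟨j, ⟨hj, hji⟩, hle⟩ := exists_le_of_biInf_le hS.sdiff (hprime i hi) h
      exact hji (hanti i hi j hj hle)
    obtain ⟨u, hu, hui⟩ := SetLike.not_le_iff_exists.1 hother
    have hmul : Ideal.span {u} * f i ≤ ⨅ j ∈ S, f j := by
      refine le_iInf₂ fun j hj => ?_
      by_cases hji : j = i
      · exact hji ▸ Ideal.mul_le_right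
      · refine Ideal.mul_le_left.trans ((Ideal.span_singleton_le_iff_mem _).2 ?_)
        exact (iInf₂_le j ⟨hj, hji⟩ : ⨅ j ∈ S \ {i}, f j ≤ f j) hu
    refine ⟨u ^ m, fun h => hui ((hprime i hi).mem_of_pow_mem m (hPi h)), ?_⟩
    refine Ideal.pow_right_mono hmul m ?_
    rw [mul_pow]
    exact Ideal.mul_mem_mul (Ideal.pow_mem_pow (Ideal.mem_span_singleton_self u) m)
      ((iInf₂_le i hi : ⨅ j ∈ S, f j ^ m ≤ f i ^ m) hx)

end SymbolicPower

theorem symbolicPower_biInf_linIdeal {S : Set (LinSub K N)} (hS : S.Finite)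
    (hanti : IsAntichain (· ≤ ·) S) (m : ℕ) :
    symbolicPower (⨅ L ∈ S, linIdeal L) m = ⨅ L ∈ S, linIdeal L ^ m :=
  symbolicPower_biInf hS (fun L _ => linIdeal_isPrime L)
    (fun _ hL _ hL' hle => (hanti.eq hL hL' (linIdeal_le_linIdeal_iff.1 hle)).symm)
    fun _ _ _ hu _ => mem_linIdeal_pow_of_mul_mem hu

theorem symbolicPower_linIdeal (L : LinSub K N) (m : ℕ) :
    symbolicPower (linIdeal L) m = linIdeal L ^ m := by
  simpa using symbolicPower_biInf_linIdeal (Set.finite_singleton L) IsAntichain.singleton m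

section Star

variable {s t e m : ℕ} {H : Fin s → Module.Dual K (Fin (N + 1) → K)} {T : Finset (LinSub K N)}
  {μ : LinSub K N → ℕ} {L : LinSub K N}

theorem ne_bot_of_codim_le (h : codim L ≤ N) : L ≠ ⊥ := by
  rintro rfl
  have hfin := (Submodule.quotEquivOfEqBot (⊥ : LinSub K N) rfl).finrank_eq
  rw [Module.finrank_fin_fun] at hfin
  rw [codim] at h
  lia

theorem ne_top_of_one_le_codim (h : 1 ≤ codim L) : L ≠ ⊤ := by
  rintro rfl
  rw [codim, Module.finrank_zero_of_subsingleton] at h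
  lia

theorem codim_eq_finrank_dualAnnihilator (L : LinSub K N) :
    codim L = Module.finrank K L.dualAnnihilator := by
  rw [codim, ← Subspace.dual_finrank_eq]
  exact L.dualQuotEquivDualAnnihilator.finrank_eq

theorem InGeneralPosition.ne_zero (hH : InGeneralPosition H) (j : Fin s) : H j ≠ 0 :=
  (hH {j} (by simp)).ne_zero ⟨j, by simp⟩

theorem finite_starSubspaces (H : Fin s → Module.Dual K (Fin (N + 1) → K)) (e : ℕ) :
    (starSubspaces H e).Finite :=
  (Set.finite_range fun J : Finset (Fin s) => ⨅ j ∈ J, LinearMap.ker (H j)).subset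
    fun _ ⟨J, _, hL⟩ => ⟨J, hL.symm⟩

theorem starSubspaces_nonempty (hes : e ≤ s) : (starSubspaces H e).Nonempty := by
  obtain ⟨J, _, hJ⟩ := Finset.exists_subset_card_eq (s := (Finset.univ : Finset (Fin s)))
    (n := e) (by simpa using hes)
  exact ⟨_, J, hJ, rfl⟩

theorem codim_of_mem_starSubspaces (hH : InGeneralPosition H) (he : e ≤ N + 1)
    (hL : L ∈ starSubspaces H e) : codim L = e := by
  obtain ⟨J, hJ, rfl⟩ := hL
  rw [codim_eq_finrank_dualAnnihilator, dualAnnihilator_biInf_ker, Set.image_eq_range]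
  exact (finrank_span_eq_card (hH J (by lia))).trans (by simpa using hJ)

theorem isAntichain_starSubspaces (hH : InGeneralPosition H) (he : e ≤ N + 1) :
    IsAntichain (· ≤ ·) (starSubspaces H e) := by
  intro L hL L' hL' hne hle
  have hcodim : codim L = codim L' :=
    (codim_of_mem_starSubspaces hH he hL).trans (codim_of_mem_starSubspaces hH he hL').symm
  simp only [codim] at hcodim
  refine hne (Submodule.eq_of_le_of_finrank_eq hle ?_)
  have hfin := L.finrank_quotient_add_finrank
  have hfin' := L'.finrank_quotient_add_finrank
  lia

theorem symbolicPower_starIdeal (hH : InGeneralPosition H) (he : e ≤ N + 1) :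
    symbolicPower (starIdeal H e) m = ⨅ L ∈ starSubspaces H e, linIdeal L ^ m :=
  symbolicPower_biInf_linIdeal (finite_starSubspaces H e) (isAntichain_starSubspaces hH he) m

/-- The linear subspaces that support `W = W' + m S_N(e, s)`: those occurring in `W'` with positive
multiplicity and those of the star configuration. -/
def components (H : Fin s → Module.Dual K (Fin (N + 1) → K)) (e : ℕ) (T : Finset (LinSub K N))
    (μ : LinSub K N → ℕ) : Set (LinSub K N) :=
  {M | M ∈ T ∧ 0 < μ M} ∪ starSubspaces H e

open Classical in
/-- The multiplicity in `W = W' + m S_N(e, s)` of a member of `components H e T μ`. -/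
def multiplicity (H : Fin s → Module.Dual K (Fin (N + 1) → K)) (e m : ℕ) (μ : LinSub K N → ℕ)
    (L : LinSub K N) : ℕ :=
  if L ∈ starSubspaces H e then m else μ L

theorem finite_components (H : Fin s → Module.Dual K (Fin (N + 1) → K)) (e : ℕ)
    (T : Finset (LinSub K N)) (μ : LinSub K N → ℕ) : (components H e T μ).Finite :=
  (T.finite_toSet.subset fun _ hM => hM.1).union (finite_starSubspaces H e)

theorem multiplicity_of_mem (hL : L ∈ starSubspaces H e) : multiplicity H e m μ L = m :=
  if_pos hL

theorem multiplicity_of_notMem (hL : L ∉ starSubspaces H e) : multiplicity H e m μ L = μ L :=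
  if_neg hL

theorem IsAdmissible.notMem_starSubspaces (hT : IsAdmissible H e t T μ) (hL : L ∈ T)
    (hμ : 0 < μ L) : L ∉ starSubspaces H e := fun h => hT.not_star_le L hL hμ L h le_rfl

theorem ideal_eq_biInf_components (hH : InGeneralPosition H) (he : e ≤ N + 1)
    (hT : IsAdmissible H e t T μ) :
    ideal H e m T μ = ⨅ L ∈ components H e T μ, linIdeal L ^ multiplicity H e m μ L := by
  simp only [ideal, symbolicPower_linIdeal, symbolicPower_starIdeal hH he, components, iInf_union]
  congr 1
  · refine le_antisymm (le_iInf₂ fun M ⟨hM, hμ⟩ => ?_) (le_iInf₂ fun M hM => ?_)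
    · rw [multiplicity_of_notMem (hT.notMem_starSubspaces hM hμ)]
      exact iInf₂_le M hM
    · rcases Nat.eq_zero_or_pos (μ M) with hμ | hμ
      · simp [hμ]
      · exact (iInf₂_le M ⟨hM, hμ⟩).trans_eq
          (by rw [multiplicity_of_notMem (hT.notMem_starSubspaces hM hμ)])
  · exact iInf_congr fun L => iInf_congr fun hL => by rw [multiplicity_of_mem hL]

theorem symbolicPower_ideal_le (hH : InGeneralPosition H) (he : e ≤ N + 1) (hm : m ≠ 0)
    (hT : IsAdmissible H e t T μ) (hL : L ∈ starSubspaces H e) (k : ℕ) :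
    symbolicPower (ideal H e m T μ) k ≤ linIdeal L ^ (m * k) := by
  have hmin : ∀ L' ∈ components H e T μ, linIdeal L' ≤ linIdeal L → linIdeal L' = linIdeal L := by
    rintro L' (⟨hL', hμ⟩ | hL') hle <;> rw [linIdeal_le_linIdeal_iff] at hle
    · exact absurd hle (hT.not_star_le L' hL' hμ L hL)
    · rw [(isAntichain_starSubspaces hH he).eq hL hL' hle]
  have hmult : multiplicity H e m μ L = m := multiplicity_of_mem hL
  have hle := symbolicPower_biInf_pow_le (f := linIdeal) (n := multiplicity H e m μ) (k := k)
    (finite_components H e T μ) (Or.inr hL) (linIdeal_isPrime L) (hmult.symm ▸ hm) hmin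
    fun _ hu _ => mem_linIdeal_pow_of_mul_mem hu
  rwa [← ideal_eq_biInf_components hH he hT, hmult] at hle

theorem le_degree_of_forall_mem_linIdeal_pow (hH : InGeneralPosition H) (he : 1 ≤ e) (heN : e ≤ N)
    (hes : e ≤ s) {c : ℕ} {G : CoordRing K N} (hG0 : G ≠ 0)
    (hG : ∀ L ∈ starSubspaces H e, G ∈ linIdeal L ^ (e * c)) : s * c ≤ G.totalDegree := by
  have hbound := card_mul_le_mul_totalDegree (S := Finset.univ) he (by simpa using hes)
    (fun J _ hJ => hH J (by lia)) hG0 fun J hJ => hG _ ⟨J, (Finset.mem_powersetCard.1 hJ).2, rfl⟩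
  rw [Finset.card_univ, Fintype.card_fin, mul_left_comm] at hbound
  exact le_of_mul_le_mul_left hbound he

theorem prod_linForm_mem_linIdeal_pow_of_mem_starSubspaces (hL : L ∈ starSubspaces H e) :
    ∏ j, linForm (H j) ∈ linIdeal L ^ e := by
  obtain ⟨J, rfl, rfl⟩ := hL
  refine Ideal.mem_of_dvd _ (Finset.prod_dvd_prod_of_subset J _ _ (Finset.subset_univ J)) ?_
  rw [← Finset.prod_const]
  exact Ideal.prod_mem_prod fun j hj =>
    linForm_mem_linIdeal (mem_dualAnnihilator_iff_le_ker.2 (iInf₂_le j hj))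

theorem prod_linForm_mem_linIdeal_of_subset_iUnion [Infinite K]
    (hL : (L : Set (Fin (N + 1) → K)) ⊆ ⋃ j, (LinearMap.ker (H j) : Set (Fin (N + 1) → K))) :
    ∏ j, linForm (H j) ∈ linIdeal L := by
  obtain ⟨j, hj⟩ := exists_le_of_subset_iUnion hL
  exact Ideal.mem_of_dvd _ (Finset.dvd_prod_of_mem (fun j => linForm (H j)) (Finset.mem_univ j))
    (linForm_mem_linIdeal (mem_dualAnnihilator_iff_le_ker.2 hj))

theorem prod_linForm_pow_mem_ideal [Infinite K] (hH : InGeneralPosition H) (he : e ≤ N + 1)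
    (hT : IsAdmissible H e t T μ) : (∏ j, linForm (H j)) ^ t ∈ ideal H e (e * t) T μ := by
  simp only [ideal, symbolicPower_linIdeal, symbolicPower_starIdeal hH he, Ideal.mem_inf,
    Submodule.mem_iInf]
  refine ⟨fun M hM => ?_, fun L hL => ?_⟩
  · exact Ideal.pow_le_pow_right (hT.mult_le M hM)
      (Ideal.pow_mem_pow (prod_linForm_mem_linIdeal_of_subset_iUnion (hT.subset_union M hM)) t)
  · rw [pow_mul]
    exact Ideal.pow_mem_pow (prod_linForm_mem_linIdeal_pow_of_mem_starSubspaces hL) t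

theorem alpha_symbolicPower_ideal [Infinite K] (hH : InGeneralPosition H) (ht : 1 ≤ t)
    (he : 1 ≤ e) (heN : e ≤ N) (hes : e ≤ s) (hT : IsAdmissible H e t T μ) (k : ℕ) :
    alpha (symbolicPower (ideal H e (e * t) T μ) k) = s * t * k := by
  refine IsLeast.csInf_eq ⟨⟨((∏ j, linForm (H j)) ^ t) ^ k, ?_, ?_, ?_⟩, ?_⟩
  · exact pow_le_symbolicPower _ k
      (Ideal.pow_mem_pow (prod_linForm_pow_mem_ideal hH (by lia) hT) k)
  · exact pow_ne_zero k (pow_ne_zero t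
      (Finset.prod_ne_zero_iff.2 fun j _ => linForm_eq_zero_iff.not.2 (hH.ne_zero j)))
  · simpa using ((isHomogeneous_prod_linForm H Finset.univ).pow t).pow k
  · rintro δ ⟨G, hG, hG0, hδ⟩
    rw [mul_assoc]
    refine (le_degree_of_forall_mem_linIdeal_pow hH he heN hes hG0 fun L hL => ?_).trans
      hδ.totalDegree_le
    rw [← mul_assoc]
    exact symbolicPower_ideal_le hH (by lia) (Nat.mul_pos he ht).ne' hT hL k hG

theorem isFatFlatIdeal_ideal (hH : InGeneralPosition H) (hm : 1 ≤ m) (he : 1 ≤ e) (heN : e ≤ N)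
    (hes : e ≤ s) (hT : IsAdmissible H e t T μ)
    (hanti : IsAntichain (· ≤ ·) (components H e T μ)) : IsFatFlatIdeal (ideal H e m T μ) := by
  have hfin := finite_components H e T μ
  refine ⟨hfin.toFinset, multiplicity H e m μ, ?_, fun L hL => ?_, by simpa using hanti, ?_⟩
  · exact hfin.toFinset_nonempty.2 ((starSubspaces_nonempty hes).mono Set.subset_union_right)
  · rcases hfin.mem_toFinset.1 hL with ⟨hLT, hμ⟩ | hLstar
    · have hcodim := hT.codim_mem L hLT
      exact ⟨ne_bot_of_codim_le hcodim.2, ne_top_of_one_le_codim (by lia),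
        (multiplicity_of_notMem (hT.notMem_starSubspaces hLT hμ)).symm ▸ hμ⟩
    · have hcodim := codim_of_mem_starSubspaces hH (by lia) hLstar
      exact ⟨ne_bot_of_codim_le (by lia), ne_top_of_one_le_codim (by lia),
        (multiplicity_of_mem hLstar).symm ▸ hm⟩
  · rw [ideal_eq_biInf_components hH (by lia) hT]
    simp only [hfin.mem_toFinset]

end Star

theorem exists_inGeneralPosition [Infinite K] (s : ℕ) :
    ∃ H : Fin s → Module.Dual K (Fin (N + 1) → K), InGeneralPosition H := by
  let a : Fin s ↪ K := Fin.valEmbedding.trans (Infinite.natEmbedding K)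
  refine ⟨fun j => ∑ i : Fin (N + 1), a j ^ (i : ℕ) • LinearMap.proj i, fun J hJ => ?_⟩
  rw [Fintype.linearIndependent_iff]
  intro g hg
  let σ := J.equivFin
  have hvandermonde : (fun i => g (σ.symm i)) = 0 := by
    refine Matrix.eq_zero_of_forall_pow_sum_mul_pow_eq_zero
      (f := fun i => a (σ.symm i)) (fun i j hij => ?_) fun i => ?_
    · simpa using a.injective hij
    · have hcoord := LinearMap.congr_fun hg (Pi.single (Fin.castLE hJ i) 1)
      rw [← Equiv.sum_comp σ.symm] at hcoord
      simpa [Pi.single_apply] using hcoord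
  intro j
  simpa using congrFun hvandermonde (σ j)

theorem isWaldschmidtConstant_of_forall {I : Ideal (CoordRing K N)} {d : ℕ}
    (h : ∀ k : ℕ, 1 ≤ k → alpha (symbolicPower I k) = d * k) : IsWaldschmidtConstant I d := by
  have hdiv : ∀ k : ℕ, 1 ≤ k → (alpha (symbolicPower I k) : ℝ) / k = d := fun k hk => by
    rw [h k hk, Nat.cast_mul, mul_div_cancel_right₀ _ (by positivity)]
  refine ⟨tendsto_const_nhds.congr' ?_, IsLeast.isGLB ⟨⟨1, le_rfl, (hdiv 1 le_rfl).symm⟩, ?_⟩⟩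
  · exact (eventually_ge_atTop 1).mono fun k hk => (hdiv k hk).symm
  · rintro _ ⟨k, hk, rfl⟩
    exact (hdiv k hk).ge

end

end FatFlat

open FatFlat in
theorem theoremA_general (K : Type*) [Field K] [Infinite K] (N : ℕ) (hN : 1 ≤ N) (d : ℕ)
    (hd : 1 ≤ d) :
    (∃ I : Ideal (CoordRing K N), IsFatFlatIdeal I ∧
      (∀ k : ℕ, 1 ≤ k → alpha (symbolicPower I k) = d * k) ∧
      IsWaldschmidtConstant I (d : ℝ)) ∧
    (∀ s t e : ℕ, d = s * t → 1 ≤ e → e ≤ N → e ≤ s →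
      (∃ H : Fin s → Module.Dual K (Fin (N + 1) → K), InGeneralPosition H) ∧
      ∀ H : Fin s → Module.Dual K (Fin (N + 1) → K), InGeneralPosition H →
        ∀ (T : Finset (LinSub K N)) (μ : LinSub K N → ℕ),
          IsAdmissible H e t T μ →
          (∀ k : ℕ, 1 ≤ k →
            alpha (symbolicPower (ideal H e (e * t) T μ) k) = d * k) ∧
          IsWaldschmidtConstant (ideal H e (e * t) T μ) (d : ℝ) ∧
          (IsAntichain (· ≤ ·) ({M | M ∈ T ∧ 0 < μ M} ∪ starSubspaces H e) →
            IsFatFlatIdeal (ideal H e (e * t) T μ))) := by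
  refine ⟨?_, ?_⟩
  · obtain ⟨H, hH⟩ := exists_inGeneralPosition (K := K) (N := N) d
    have he : 1 ≤ min d N := le_min hd hN
    have hT : IsAdmissible H (min d N) 1 ∅ 0 := by constructor <;> simp
    have hanti : IsAntichain (· ≤ ·) (components H (min d N) ∅ 0) := by
      simpa [components] using isAntichain_starSubspaces hH (by lia)
    have halpha (k : ℕ) (_ : 1 ≤ k) :
        alpha (symbolicPower (ideal H (min d N) (min d N * 1) ∅ 0) k) = d * k := by
      simpa using alpha_symbolicPower_ideal hH le_rfl he (by lia) (by lia) hT k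
    exact ⟨_, isFatFlatIdeal_ideal hH (by lia) he (by lia) (by lia) hT hanti, halpha,
      isWaldschmidtConstant_of_forall halpha⟩
  · rintro s t e rfl he heN hes
    refine ⟨exists_inGeneralPosition s, fun H hH T μ hT => ?_⟩
    have ht : 1 ≤ t := Nat.pos_of_mul_pos_left hd
    have halpha (k : ℕ) (_ : 1 ≤ k) := alpha_symbolicPower_ideal hH ht he heN hes hT k
    exact ⟨halpha, isWaldschmidtConstant_of_forall halpha,
      isFatFlatIdeal_ideal hH (Nat.mul_pos he ht) he heN hes hT⟩

theorem theoremA (K : Type*) [Field K] [Infinite K] (N : ℕ) (hN : 3 ≤ N) (d : ℕ) (hd : 1 ≤ d) :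
    -- a fat flat subscheme of `ℙ^N` with the stated invariants exists
    (∃ I : Ideal (FatFlat.CoordRing K N), FatFlat.IsFatFlatIdeal I ∧
      (∀ k : ℕ, 1 ≤ k → FatFlat.alpha (FatFlat.symbolicPower I k) = d * k) ∧
      FatFlat.IsWaldschmidtConstant I (d : ℝ)) ∧
    -- every `W' + m S_N(e, s)` with `d = s t` and `m = e t` has them
    (∀ s t e : ℕ, d = s * t → 1 ≤ e → e ≤ N → e ≤ s →
      (∃ H : Fin s → Module.Dual K (Fin (N + 1) → K), FatFlat.InGeneralPosition H) ∧
      ∀ H : Fin s → Module.Dual K (Fin (N + 1) → K), FatFlat.InGeneralPosition H →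
        ∀ (T : Finset (FatFlat.LinSub K N)) (μ : FatFlat.LinSub K N → ℕ),
          FatFlat.IsAdmissible H e t T μ →
          (∀ k : ℕ, 1 ≤ k →
            FatFlat.alpha (FatFlat.symbolicPower (FatFlat.ideal H e (e * t) T μ) k) = d * k) ∧
          FatFlat.IsWaldschmidtConstant (FatFlat.ideal H e (e * t) T μ) (d : ℝ) ∧
          (IsAntichain (· ≤ ·) ({M | M ∈ T ∧ 0 < μ M} ∪ FatFlat.starSubspaces H e) →
            FatFlat.IsFatFlatIdeal (FatFlat.ideal H e (e * t) T μ))) :=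
  theoremA_general K N (by lia) d hd
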